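/- Let $a,b,c\in\mathbb R$ with $c>0$ and $a+b>0$, and put $k=\sqrt{(a+b)/c}$. For $X>0$, a *solution on $[0,X]$* means a function $u\in C^0([0,X])\cap C^2((0,X))$ with $u(0)=0$ and $$x^2u''(x)=a\,x\,u'(x)+b\,u(x)-c\,(u'(x)-1)^2\qquad\text{for all }x\in(0,X).$$ Let $x_0>0$ and $l>0$, and let $u$ be a solution on $[0,x_0]$ such that $$\Big|\frac{u'(x)-1}{\sqrt x}+k\Big|\le l\sqrt x\qquad\text{for all }x\in(0,x_0).$$ Then for all real numbers $\underline\alpha<\tfrac32+a-2cl$ and $\overline\alpha>\tfrac32+a+2cl$ there exists $\hat x_0$ with $0<\hat x_0<\min\{x_0,1\}$ such that for every $\varepsilon\in(0,1)$ and every $$\hat u_0\in\Big(u(\hat x_0)-\varepsilon\hat x_0^{\underline\alpha}e^{-4ck/\sqrt{\hat x_0}},\ u(\hat x_0)-\varepsilon\hat x_0^{\overline\alpha}e^{-4ck/\sqrt{\hat x_0}}\Big)$$ (an interval that is nonempty because $\hat x_0<1$ and $\underline\alpha<\overline\alpha$) there is a solution $\hat u$ on $[0,\hat x_0]$ with $\hat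 u(\hat x_0)=\hat u_0$ and $$u(x)-\varepsilon x^{\underline\alpha}e^{-4ck/\sqrt x}\le\hat u(x)\le u(x)-\varepsilon x^{\overline\alpha}e^{-4ck/\sqrt x}\qquad\text{for all }x\in(0,\hat x_0).$$ -/

import Mathlib

/-- `u` is a solution on `[0, x₀]` of the singular initial value problem
`x² u'' = a x u' + b u - c (u' - 1)²` for `0 < x < x₀`, `u 0 = 0`:
`u` is continuous on `[0, x₀]`, twice continuously differentiable on `(0, x₀)`,
satisfies the equation on `(0, x₀)` and vanishes at `0`. Values of `u` outside `[0, x₀]`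
play no role. -/
structure IsSolution (a b c x₀ : ℝ) (u : ℝ → ℝ) : Prop where
  continuousOn : ContinuousOn u (Set.Icc 0 x₀)
  contDiffOn : ContDiffOn ℝ 2 u (Set.Ioo 0 x₀)
  equation : ∀ x ∈ Set.Ioo 0 x₀,
    x ^ 2 * deriv (deriv u) x = a * x * deriv u x + b * u x - c * (deriv u x - 1) ^ 2
  initial : u 0 = 0

/-- The constant `k = √((a + b) / c)`. -/
noncomputable def kCoeff (a b c : ℝ) : ℝ := Real.sqrt ((a + b) / c)

/-- The function `x ↦ u x - ε x ^ α exp (-4 c k / √x)`, with `k = √((a + b) / c)`. -/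
noncomputable def expPerturbation (a b c : ℝ) (u : ℝ → ℝ) (ε α x : ℝ) : ℝ :=
  u x - ε * x ^ α * Real.exp (-(4 * c * kCoeff a b c) / Real.sqrt x)

open Set Filter Topology MeasureTheory

/-! Write `û = u - w`. The equation for `û` becomes `x² w'' = x² q w' + b w + c w'²` with `w 0 = 0`,
where `x² q = a x - 2c (u' - 1)`. With `m = c k`, the hypothesis on `u'` says that `x^{3/2} q`
differs from `2m + a√x` by at most `2cl√x`. So the integrating factor `Q = exp ∫ q` vanishes at `0`
to all orders, roughly like `exp(-4m/√x)`, and the terms `b w` and `c w'²` are perturbations.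

Existence (`exists_perturbation`): put `w' = g Q h`. Then `h' = β ∫ Q h + γ h²` with `β = b/(x² Q)`
and `γ = c g Q/x²`. The monotonicity of `Q/x^{3/2}` and the bound `m ∫ Q ≤ x^{3/2} Q` make the
right-hand side `O(1/√x)`, hence of integral `O(√X)`. A contraction near `h = 1`, normalised to have
`Q`-mean `1`, gives `w X = g ∫ Q`, and `g` is chosen to match the prescribed value.

Bounds (`mul_rpow_mul_exp_le`): the logarithmic derivative `ρ` of `w'` satisfies the same estimate
as `q` up to `O(x)` in `x^{3/2} ρ`. Comparing `w` with `x^α exp(-4m/√x)` leaves the leading term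
`(3/2 + a - α)√x`, uncertain by `2cl√x`. Its sign is therefore fixed for both exponents, and the
quotient is increasing for the lower one and decreasing for the upper one. The bounds at `X` thus
propagate to all of `(0, X)`. -/

/-! ### The integrating factor; `x * √x` plays the role of `x^{3/2}`. -/

theorem hasDerivAt_mul_sqrt {x : ℝ} (hx : 0 < x) :
    HasDerivAt (fun y : ℝ => y * √y) (3 / 2 * √x) x := by
  have h1 : 0 < √x := Real.sqrt_pos.2 hx
  have h2 : √x * √x = x := Real.mul_self_sqrt hx.le
  have h3 : 3 / 2 * √x = 1 * √x + x * (1 / (2 * √x)) := by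
    field_simp
    nlinarith
  rw [h3]
  exact (hasDerivAt_id' x).mul (Real.hasDerivAt_sqrt hx.ne')

theorem mul_sqrt_pos {x : ℝ} (hx : 0 < x) : 0 < x * √x :=
  mul_pos hx (Real.sqrt_pos.2 hx)

/-- Solutions of the linear equation `Q' = q Q` with a coefficient bounded below by
`m / (x √x)` near `0` extend continuously by `0` to the origin. -/
theorem exists_weight {q : ℝ → ℝ} {m X : ℝ} (hX : 0 < X)
    (hq : ContinuousOn q (Ioc 0 X)) (hlow : ∀ x ∈ Ioc 0 X, m ≤ x * √x * q x)
    (hXm : 3 / 2 * √X ≤ m) :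
    ∃ Q : ℝ → ℝ, Continuous Q ∧ Q 0 = 0 ∧ (∀ x ∈ Ioc 0 X, 0 < Q x) ∧
      (∀ x ∈ Ioo 0 X, HasDerivAt Q (q x * Q x) x) ∧
      MonotoneOn (fun x => Q x / (x * √x)) (Ioc 0 X) := by
  set P : ℝ → ℝ := fun x => Real.exp (∫ s in X..x, q s) with hP
  have hII : ∀ x ∈ Ioc 0 X, IntervalIntegrable q volume X x := by
    intro x hx
    apply ContinuousOn.intervalIntegrable
    rw [uIcc_of_ge hx.2]
    exact hq.mono fun y hy => ⟨hx.1.trans_le hy.1, hy.2⟩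
  have hPd : ∀ x ∈ Ioo 0 X, HasDerivAt P (q x * P x) x := by
    intro x hx
    have hc : ContinuousOn q (Ioo 0 X) := hq.mono Ioo_subset_Ioc_self
    have h1 : HasDerivAt (fun x => ∫ s in X..x, q s) (q x) x :=
      intervalIntegral.integral_hasDerivAt_right (hII x ⟨hx.1, hx.2.le⟩)
        (hc.stronglyMeasurableAtFilter isOpen_Ioo x hx)
        (hc.continuousAt (isOpen_Ioo.mem_nhds hx))
    have := h1.exp
    rwa [mul_comm] at this
  have hPc : ContinuousOn P (Ioc 0 X) := by
    apply Real.continuous_exp.comp_continuousOn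
    intro x hx
    have hx2 : x / 2 ∈ Ioc 0 X := ⟨by linarith [hx.1], by linarith [hx.1, hx.2]⟩
    have hcont : ContinuousOn (fun x => ∫ s in X..x, q s) (uIcc X (x / 2)) := by
      apply intervalIntegral.continuousOn_primitive_interval
      rw [uIcc_of_ge hx2.2]
      apply ContinuousOn.integrableOn_Icc
      exact hq.mono fun y hy => ⟨hx2.1.trans_le hy.1, hy.2⟩
    rw [uIcc_of_ge hx2.2] at hcont
    have := hcont x ⟨by linarith [hx.1], hx.2⟩
    apply this.mono_of_mem_nhdsWithin
    rw [mem_nhdsWithin]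
    exact ⟨Ioi (x / 2), isOpen_Ioi, by simp; linarith [hx.1],
      fun y hy => ⟨le_of_lt hy.1, hy.2.2⟩⟩
  have hPpos : ∀ x, 0 < P x := fun x => Real.exp_pos _
  -- The logarithmic derivative of `P` is at least `m / (x√x)`, that of `x√x` is `3/(2x)`; `3/2 √X ≤
  -- m` makes the first dominate. This also forces `P → 0` at `0`.
  have hmono : MonotoneOn (fun x => P x / (x * √x)) (Ioc 0 X) := by
    have hd : ∀ x ∈ Ioo 0 X, HasDerivAt (fun x => P x / (x * √x))
        ((q x * P x * (x * √x) - P x * (3 / 2 * √x)) / (x * √x) ^ 2) x := by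
      intro x hx
      exact (hPd x hx).div (hasDerivAt_mul_sqrt hx.1) (mul_sqrt_pos hx.1).ne'
    apply monotoneOn_of_deriv_nonneg (convex_Ioc 0 X)
    · apply hPc.div
      · fun_prop
      · intro x hx
        exact (mul_sqrt_pos hx.1).ne'
    · rw [interior_Ioc]
      exact fun x hx => (hd x hx).differentiableAt.differentiableWithinAt
    · rw [interior_Ioc]
      intro x hx
      rw [(hd x hx).deriv]
      apply div_nonneg _ (sq_nonneg _)
      have h1 := hlow x ⟨hx.1, hx.2.le⟩
      have h2 : √x ≤ √X := Real.sqrt_le_sqrt hx.2.le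
      have : q x * P x * (x * √x) - P x * (3 / 2 * √x)
        = P x * (x * √x * q x - 3 / 2 * √x) := by ring
      rw [this]
      exact mul_nonneg (hPpos x).le (by linarith)
  set Q₀ : ℝ → ℝ := fun x => if 0 < x then P x else 0 with hQ₀
  have hQP : ∀ x, 0 < x → Q₀ x = P x := fun x hx => by simp [hQ₀, hx]
  have hQ0 : Q₀ 0 = 0 := by simp [hQ₀]
  have hev : ∀ x, 0 < x → Q₀ =ᶠ[𝓝 x] P := fun x hx =>
    (eventually_gt_nhds hx).mono hQP
  have hQc : ContinuousOn Q₀ (Icc 0 X) := by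
    intro x hx
    rcases hx.1.eq_or_lt with rfl | hx0
    · have hlim : Tendsto (fun x : ℝ => P X / (X * √X) * (x * √x)) (𝓝[Icc 0 X] 0) (𝓝 0) := by
        have : Continuous (fun x : ℝ => P X / (X * √X) * (x * √x)) := by fun_prop
        have h2 := (this.tendsto 0).mono_left (nhdsWithin_le_nhds (s := Icc 0 X))
        simpa using h2
      unfold ContinuousWithinAt
      rw [hQ0]
      refine tendsto_of_tendsto_of_tendsto_of_le_of_le' tendsto_const_nhds hlim ?_ ?_
      · refine Eventually.of_forall fun y => ?_
        by_cases hy : 0 < y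
        · rw [hQP y hy]; exact (hPpos y).le
        · simp [hQ₀, hy]
      · filter_upwards [self_mem_nhdsWithin] with y hy
        rcases hy.1.eq_or_lt with rfl | hy0
        · simp [hQ0]
        · rw [hQP y hy0]
          have := hmono ⟨hy0, hy.2⟩ ⟨hX, le_rfl⟩ hy.2
          simp only at this
          rwa [div_le_iff₀ (mul_sqrt_pos hy0)] at this
    · have h1 := hPc x ⟨hx0, hx.2⟩
      have h2 : ContinuousWithinAt P (Icc 0 X) x := by
        apply h1.mono_of_mem_nhdsWithin
        rw [mem_nhdsWithin]
        exact ⟨Ioi 0, isOpen_Ioi, hx0, fun y hy => ⟨hy.1, hy.2.2⟩⟩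
      exact h2.congr_of_eventuallyEq ((hev x hx0).filter_mono nhdsWithin_le_nhds) (hQP x hx0)
  -- Constant extension beyond `[0, X]` makes the weight continuous on the whole line, so its
  -- primitives are differentiable everywhere.
  have hext : ∀ x ∈ Icc 0 X, IccExtend hX.le ((Icc 0 X).domRestrict Q₀) x = Q₀ x := fun x hx => by
    rw [IccExtend_of_mem _ _ hx]; rfl
  refine ⟨IccExtend hX.le ((Icc 0 X).domRestrict Q₀), ?_, ?_, ?_, ?_, ?_⟩
  · exact (continuousOn_iff_continuous_domRestrict.1 hQc).Icc_extend'
  · rw [hext 0 ⟨le_rfl, hX.le⟩, hQ0]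
  · intro x hx
    rw [hext x ⟨hx.1.le, hx.2⟩, hQP x hx.1]
    exact hPpos x
  · intro x hx
    rw [hext x ⟨hx.1.le, hx.2.le⟩, hQP x hx.1]
    apply (hPd x hx).congr_of_eventuallyEq
    filter_upwards [isOpen_Ioo.mem_nhds hx] with y hy
    rw [hext y ⟨hy.1.le, hy.2.le⟩, hQP y hy.1]
  · refine hmono.congr ?_
    intro x hx
    simp only
    rw [hext x ⟨hx.1.le, hx.2⟩, hQP x hx.1]

/-- A continuous function on `[0, X]` vanishing at `0` with nonnegative derivative is
nonnegative. -/
theorem nonneg_of_hasDerivAt_nonneg {f f' : ℝ → ℝ} {X : ℝ}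
    (hc : ContinuousOn f (Icc 0 X)) (h0 : f 0 = 0)
    (hd : ∀ x ∈ Ioo 0 X, HasDerivAt f (f' x) x) (hf' : ∀ x ∈ Ioo 0 X, 0 ≤ f' x) :
    ∀ x ∈ Icc 0 X, 0 ≤ f x := by
  have hm : MonotoneOn f (Icc 0 X) := by
    apply monotoneOn_of_deriv_nonneg (convex_Icc 0 X) hc
    · rw [interior_Icc]
      exact fun x hx => (hd x hx).differentiableAt.differentiableWithinAt
    · rw [interior_Icc]
      intro x hx
      rw [(hd x hx).deriv]
      exact hf' x hx
  intro x hx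
  rw [← h0]
  exact hm ⟨le_rfl, hx.1.trans hx.2⟩ hx hx.1

theorem hasDerivAt_primitive {f : ℝ → ℝ} (hf : Continuous f) (x : ℝ) :
    HasDerivAt (fun x => ∫ s in (0 : ℝ)..x, f s) (f x) x :=
  intervalIntegral.integral_hasDerivAt_right (hf.intervalIntegrable _ _)
    (hf.stronglyMeasurableAtFilter _ _) hf.continuousAt

theorem continuous_primitive_zero {f : ℝ → ℝ} (hf : Continuous f) :
    Continuous (fun x => ∫ s in (0 : ℝ)..x, f s) :=
  continuous_iff_continuousAt.2 fun x => (hasDerivAt_primitive hf x).continuousAt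

/-- Both sides vanish at `0`, and `(x√x Q)' ≥ x√x q Q ≥ m Q`. This controls the term `b w` by `w'`.
-/
theorem mul_integral_weight_le {q Q : ℝ → ℝ} {m X : ℝ}
    (hlow : ∀ x ∈ Ioc 0 X, m ≤ x * √x * q x)
    (hQ : Continuous Q) (hpos : ∀ x ∈ Ioc 0 X, 0 < Q x)
    (hd : ∀ x ∈ Ioo 0 X, HasDerivAt Q (q x * Q x) x) :
    ∀ x ∈ Icc 0 X, m * ∫ s in (0 : ℝ)..x, Q s ≤ x * √x * Q x := by
  intro x hx
  have := nonneg_of_hasDerivAt_nonneg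
    (f := fun x => x * √x * Q x - m * ∫ s in (0 : ℝ)..x, Q s)
    (f' := fun x => (3 / 2 * √x * Q x + x * √x * (q x * Q x)) - m * Q x) (X := X)
    (by have := continuous_primitive_zero hQ; fun_prop) (by simp)
    (fun x hx => ((hasDerivAt_mul_sqrt hx.1).mul (hd x hx)).sub
      ((hasDerivAt_primitive hQ x).const_mul m))
    (fun x hx => by
      have h1 := hlow x ⟨hx.1, hx.2.le⟩
      have h2 := hpos x ⟨hx.1, hx.2.le⟩
      have h3 := Real.sqrt_nonneg x
      have : 3 / 2 * √x * Q x + x * √x * (q x * Q x) - m * Q x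
        = 3 / 2 * √x * Q x + (x * √x * q x - m) * Q x := by ring
      rw [this]
      have := mul_nonneg (sub_nonneg.2 h1) h2.le
      positivity) x hx
  linarith

/-- Both sides vanish at `0`, and `(x² Q)' = (2x + x² q) Q ≤ Q` for small `X`. At `X` this bounds
the amplitude `g = w₀ / ∫ Q` from above. -/
theorem sq_mul_weight_le_integral {q Q : ℝ → ℝ} {m X : ℝ}
    (hup : ∀ x ∈ Ioc 0 X, x * √x * q x ≤ 3 * m)
    (hX : 2 * X + 3 * m * √X ≤ 1) (hm : 0 ≤ m)
    (hQ : Continuous Q) (hpos : ∀ x ∈ Ioc 0 X, 0 < Q x)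
    (hd : ∀ x ∈ Ioo 0 X, HasDerivAt Q (q x * Q x) x) :
    ∀ x ∈ Icc 0 X, x ^ 2 * Q x ≤ ∫ s in (0 : ℝ)..x, Q s := by
  intro x hx
  have := nonneg_of_hasDerivAt_nonneg
    (f := fun x => (∫ s in (0 : ℝ)..x, Q s) - x ^ 2 * Q x)
    (f' := fun x => Q x - (2 * x * Q x + x ^ 2 * (q x * Q x))) (X := X)
    (by have := continuous_primitive_zero hQ; fun_prop) (by simp)
    (fun x hx => (hasDerivAt_primitive hQ x).sub
      (by simpa using! (hasDerivAt_pow 2 x).mul (hd x hx)))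
    (fun x hx => by
      have h1 := hup x ⟨hx.1, hx.2.le⟩
      have h2 := hpos x ⟨hx.1, hx.2.le⟩
      have h3 := Real.sqrt_pos.2 hx.1
      have h4 : √x ≤ √X := Real.sqrt_le_sqrt hx.2.le
      have h5 : √x * √x = x := Real.mul_self_sqrt hx.1.le
      have h6 : x ^ 2 * q x ≤ 3 * m * √x := by
        have : x ^ 2 * q x = √x * (x * √x * q x) := by
          linear_combination (-x * q x) * h5
        rw [this]; nlinarith
      have h7 : 3 * m * √x ≤ 3 * m * √X := by gcongr
      have : Q x - (2 * x * Q x + x ^ 2 * (q x * Q x))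
        = (1 - 2 * x - x ^ 2 * q x) * Q x := by ring
      rw [this]
      exact mul_nonneg (by linarith [hx.2]) h2.le) x hx
  linarith

/-! ### Weighted averages and integrands dominated by `K / √s`. -/

theorem abs_integral_weight_mul_le {Q h : ℝ → ℝ} {X M : ℝ} (hQ : Continuous Q)
    (hQ0 : ∀ x ∈ Icc 0 X, 0 ≤ Q x) (hh : Continuous h) (hM : ∀ x, |h x| ≤ M) :
    ∀ x ∈ Icc 0 X, |∫ s in (0 : ℝ)..x, Q s * h s| ≤ M * ∫ s in (0 : ℝ)..x, Q s := by
  intro x hx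
  refine (intervalIntegral.abs_integral_le_integral_abs hx.1).trans ?_
  rw [← intervalIntegral.integral_const_mul]
  apply intervalIntegral.integral_mono_on hx.1
  · exact (hQ.mul hh).abs.intervalIntegrable _ _
  · exact (hQ.const_mul M).intervalIntegrable _ _
  · intro s hs
    have h0 := hQ0 s ⟨hs.1, hs.2.trans hx.2⟩
    rw [abs_mul, abs_of_nonneg h0, mul_comm]
    exact mul_le_mul_of_nonneg_right (hM s) h0

theorem integral_weight_mul_sub {Q f g : ℝ → ℝ} (hQ : Continuous Q) (hf : Continuous f)
    (hg : Continuous g) (x : ℝ) :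
    ∫ s in (0 : ℝ)..x, Q s * (f s - g s)
      = (∫ s in (0 : ℝ)..x, Q s * f s) - ∫ s in (0 : ℝ)..x, Q s * g s := by
  simp only [mul_sub]
  exact intervalIntegral.integral_sub ((hQ.mul hf).intervalIntegrable _ _)
    ((hQ.mul hg).intervalIntegrable _ _)

theorem integrable_indicator_div_sqrt (X K : ℝ) :
    Integrable ((Ioc 0 X).indicator fun s => K / √s) := by
  rw [integrable_indicator_iff measurableSet_Ioc]
  rcases le_total 0 X with hX | hX
  · rw [← intervalIntegrable_iff_integrableOn_Ioc_of_le hX]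
    have : IntervalIntegrable (fun s : ℝ => K * s ^ (-(1 / 2) : ℝ)) volume 0 X :=
      (intervalIntegral.intervalIntegrable_rpow' (by norm_num)).const_mul K
    refine this.congr_ae ?_
    filter_upwards [ae_restrict_mem measurableSet_uIoc] with s hs
    rw [uIoc_of_le hX] at hs
    rw [Real.rpow_neg hs.1.le, ← Real.sqrt_eq_rpow, div_eq_mul_inv]
  · simp [Ioc_eq_empty (not_lt.2 hX)]

theorem integral_indicator_div_sqrt {X : ℝ} (hX : 0 ≤ X) (K : ℝ) :
    ∫ s, (Ioc 0 X).indicator (fun s => K / √s) s = 2 * K * √X := by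
  rw [integral_indicator measurableSet_Ioc, ← intervalIntegral.integral_of_le hX]
  have : ∫ s in (0 : ℝ)..X, K / √s = ∫ s in (0 : ℝ)..X, K * s ^ (-(1 / 2) : ℝ) := by
    apply intervalIntegral.integral_congr_ae
    refine Eventually.of_forall fun s hs => ?_
    rw [uIoc_of_le hX] at hs
    rw [Real.rpow_neg hs.1.le, ← Real.sqrt_eq_rpow, div_eq_mul_inv]
  rw [this, intervalIntegral.integral_const_mul, integral_rpow (Or.inl (by norm_num)),
    Real.zero_rpow (by norm_num), Real.sqrt_eq_rpow]
  norm_num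
  ring

theorem integrable_of_abs_le_div_sqrt {f : ℝ → ℝ} {X K : ℝ}
    (hf : AEStronglyMeasurable f)
    (hb : ∀ s, |f s| ≤ (Ioc 0 X).indicator (fun s => K / √s) s) : Integrable f :=
  (integrable_indicator_div_sqrt X K).mono' hf (Eventually.of_forall hb)

theorem abs_integral_le_of_abs_le_div_sqrt {f : ℝ → ℝ} {X K : ℝ} (hX : 0 ≤ X)
    (hf : AEStronglyMeasurable f)
    (hb : ∀ s, |f s| ≤ (Ioc 0 X).indicator (fun s => K / √s) s) (x : ℝ) :
    |∫ s in (0 : ℝ)..x, f s| ≤ 2 * K * √X := by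
  have hi := integrable_of_abs_le_div_sqrt hf hb
  rw [← integral_indicator_div_sqrt hX K]
  refine (intervalIntegral.norm_integral_le_integral_norm_uIoc (f := f) (a := 0) (b := x)
    (μ := volume)).trans ?_
  refine (setIntegral_le_integral hi.norm (Eventually.of_forall fun s => norm_nonneg _)).trans ?_
  exact integral_mono hi.norm (integrable_indicator_div_sqrt X K) hb

/-- The right-hand side of the integro-differential equation
`h' = β ∫ Q h + γ h²` on `(0, X]`, extended by `0`. -/
noncomputable def integroField (Q β γ : ℝ → ℝ) (X : ℝ) (h : ℝ → ℝ) : ℝ → ℝ :=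
  (Ioc 0 X).indicator fun s => β s * (∫ t in (0 : ℝ)..s, Q t * h t) + γ s * h s ^ 2

/-! ### The integro-differential equation, solved by contraction. -/

section IntegroField

variable {Q β γ : ℝ → ℝ} {X B : ℝ}

theorem continuousOn_integroField (hQ : Continuous Q) (hβ : ContinuousOn β (Ioc 0 X))
    (hγ : ContinuousOn γ (Ioc 0 X)) {h : ℝ → ℝ} (hh : Continuous h) :
    ContinuousOn (integroField Q β γ X h) (Ioc 0 X) := by
  have h1 : ContinuousOn
      (fun s => β s * (∫ t in (0 : ℝ)..s, Q t * h t) + γ s * h s ^ 2) (Ioc 0 X) := by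
    have := continuous_primitive_zero (hQ.mul hh)
    fun_prop
  refine h1.congr fun s hs => ?_
  simp only [integroField, indicator_of_mem hs]

theorem aestronglyMeasurable_integroField (hQ : Continuous Q) (hβ : ContinuousOn β (Ioc 0 X))
    (hγ : ContinuousOn γ (Ioc 0 X)) {h : ℝ → ℝ} (hh : Continuous h) :
    AEStronglyMeasurable (integroField Q β γ X h) := by
  unfold integroField
  rw [aestronglyMeasurable_indicator_iff measurableSet_Ioc]
  apply ContinuousOn.aestronglyMeasurable _ measurableSet_Ioc
  have := continuous_primitive_zero (hQ.mul hh)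
  fun_prop

theorem abs_integroField_le (hQ : Continuous Q) (hQ0 : ∀ x ∈ Icc 0 X, 0 ≤ Q x)
    (hβB : ∀ s ∈ Ioc 0 X, |β s| * (∫ t in (0 : ℝ)..s, Q t) ≤ B / √s)
    (hγB : ∀ s ∈ Ioc 0 X, |γ s| ≤ 1 / √s) {h : ℝ → ℝ} (hh : Continuous h) {M : ℝ}
    (hM : ∀ x, |h x| ≤ M) (s : ℝ) :
    |integroField Q β γ X h s| ≤ (Ioc 0 X).indicator (fun s => (B * M + M ^ 2) / √s) s := by
  have hM0 : 0 ≤ M := (abs_nonneg _).trans (hM 0)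
  by_cases hs : s ∈ Ioc 0 X
  · simp only [integroField, indicator_of_mem hs]
    have h1 := abs_integral_weight_mul_le hQ hQ0 hh hM s ⟨hs.1.le, hs.2⟩
    have h2 : |h s ^ 2| ≤ M ^ 2 := by rw [abs_pow]; gcongr; exact hM s
    calc _ ≤ |β s * ∫ t in (0 : ℝ)..s, Q t * h t| + |γ s * h s ^ 2| := abs_add_le _ _
      _ = |β s| * |∫ t in (0 : ℝ)..s, Q t * h t| + |γ s| * |h s ^ 2| := by
        rw [abs_mul, abs_mul]
      _ ≤ |β s| * (M * ∫ t in (0 : ℝ)..s, Q t) + 1 / √s * M ^ 2 := by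
        gcongr; exact hγB s hs
      _ = M * (|β s| * ∫ t in (0 : ℝ)..s, Q t) + 1 / √s * M ^ 2 := by ring
      _ ≤ M * (B / √s) + 1 / √s * M ^ 2 := by gcongr; exact hβB s hs
      _ = _ := by ring
  · simp [integroField, indicator_of_notMem hs]

theorem abs_integroField_sub_le (hQ : Continuous Q) (hQ0 : ∀ x ∈ Icc 0 X, 0 ≤ Q x)
    (hβB : ∀ s ∈ Ioc 0 X, |β s| * (∫ t in (0 : ℝ)..s, Q t) ≤ B / √s)
    (hγB : ∀ s ∈ Ioc 0 X, |γ s| ≤ 1 / √s) {h₁ h₂ : ℝ → ℝ} (hh₁ : Continuous h₁)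
    (hh₂ : Continuous h₂) {M d : ℝ} (hM₁ : ∀ x, |h₁ x| ≤ M) (hM₂ : ∀ x, |h₂ x| ≤ M)
    (hd : ∀ x, |h₁ x - h₂ x| ≤ d) (s : ℝ) :
    |integroField Q β γ X h₁ s - integroField Q β γ X h₂ s| ≤
      (Ioc 0 X).indicator (fun s => ((B + 2 * M) * d) / √s) s := by
  have hd0 : 0 ≤ d := (abs_nonneg _).trans (hd 0)
  by_cases hs : s ∈ Ioc 0 X
  · simp only [integroField, indicator_of_mem hs]
    have h1 : |∫ t in (0 : ℝ)..s, Q t * (h₁ t - h₂ t)| ≤ _ :=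
      abs_integral_weight_mul_le hQ hQ0 (hh₁.sub hh₂) hd s ⟨hs.1.le, hs.2⟩
    have h2 : |(h₁ s + h₂ s) * (h₁ s - h₂ s)| ≤ 2 * M * d := by
      rw [abs_mul]
      have := (abs_add_le (h₁ s) (h₂ s)).trans (add_le_add (hM₁ s) (hM₂ s))
      exact mul_le_mul (by linarith) (hd s) (abs_nonneg _)
        (by linarith [abs_nonneg (h₁ s + h₂ s)])
    have h3 := integral_weight_mul_sub hQ hh₁ hh₂ s
    have hMd : 0 ≤ 2 * M * d := (abs_nonneg _).trans h2
    calc _ = |β s * (∫ t in (0 : ℝ)..s, Q t * (h₁ t - h₂ t))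
            + γ s * ((h₁ s + h₂ s) * (h₁ s - h₂ s))| := by rw [h3]; ring_nf
      _ ≤ _ := abs_add_le _ _
      _ = |β s| * |∫ t in (0 : ℝ)..s, Q t * (h₁ t - h₂ t)|
          + |γ s| * |(h₁ s + h₂ s) * (h₁ s - h₂ s)| := by rw [abs_mul, abs_mul]
      _ ≤ |β s| * (d * ∫ t in (0 : ℝ)..s, Q t) + 1 / √s * (2 * M * d) := by
        gcongr
        exact hγB s hs
      _ = d * (|β s| * ∫ t in (0 : ℝ)..s, Q t) + 1 / √s * (2 * M * d) := by ring
      _ ≤ d * (B / √s) + 1 / √s * (2 * M * d) := by gcongr; exact hβB s hs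
      _ = _ := by ring
  · simp [integroField, indicator_of_notMem hs]

/-- For small `X` the integro-differential equation `h' = β ∫ Q h + γ h²` has a solution close to
`1` with `Q`-average `1`. -/
theorem exists_integroField_solution (hX : 0 < X) (hQ : Continuous Q)
    (hQ0 : ∀ x ∈ Icc 0 X, 0 ≤ Q x) (hJ : 0 < ∫ t in (0 : ℝ)..X, Q t)
    (hβ : ContinuousOn β (Ioc 0 X)) (hγ : ContinuousOn γ (Ioc 0 X)) (hB : 0 ≤ B)
    (hβB : ∀ s ∈ Ioc 0 X, |β s| * (∫ t in (0 : ℝ)..s, Q t) ≤ B / √s)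
    (hγB : ∀ s ∈ Ioc 0 X, |γ s| ≤ 1 / √s) (hXB : (12 * B + 24) * √X ≤ 1) :
    ∃ h : ℝ → ℝ, Continuous h ∧ (∀ x, |h x - 1| ≤ 1 / 2) ∧
      (∫ t in (0 : ℝ)..X, Q t * h t) = (∫ t in (0 : ℝ)..X, Q t) ∧
      ∀ x ∈ Ioo 0 X,
        HasDerivAt h (β x * (∫ t in (0 : ℝ)..x, Q t * h t) + γ x * h x ^ 2) x := by
  set J := ∫ t in (0 : ℝ)..X, Q t with hJdef
  -- The indicator in `integroField` makes `G h` constant outside `[0, X]`, so bounded functions on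
  -- the whole line can serve as the complete space.
  set G : (ℝ → ℝ) → ℝ → ℝ := fun h x => ∫ s in (0 : ℝ)..x, integroField Q β γ X h s with hG
  set A : (ℝ → ℝ) → ℝ := fun h => (∫ t in (0 : ℝ)..X, Q t * G h t) / J with hA
  have hmeas : ∀ {h : ℝ → ℝ}, Continuous h → AEStronglyMeasurable (integroField Q β γ X h) :=
    fun hh => aestronglyMeasurable_integroField hQ hβ hγ hh
  have hint : ∀ {h : ℝ → ℝ} {M : ℝ}, Continuous h → (∀ x, |h x| ≤ M) →
      Integrable (integroField Q β γ X h) := fun hh hM =>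
    integrable_of_abs_le_div_sqrt (hmeas hh) (abs_integroField_le hQ hQ0 hβB hγB hh hM)
  have hGc : ∀ {h : ℝ → ℝ} {M : ℝ}, Continuous h → (∀ x, |h x| ≤ M) → Continuous (G h) :=
    fun hh hM => (hint hh hM).continuous_primitive 0
  have hGb : ∀ {h : ℝ → ℝ} {M : ℝ}, Continuous h → (∀ x, |h x| ≤ M) →
      ∀ x, |G h x| ≤ 2 * (B * M + M ^ 2) * √X := fun hh hM x =>
    abs_integral_le_of_abs_le_div_sqrt hX.le (hmeas hh)
      (abs_integroField_le hQ hQ0 hβB hγB hh hM) x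
  have havg : ∀ {f : ℝ → ℝ} {M : ℝ}, Continuous f → (∀ x, |f x| ≤ M) →
      |(∫ t in (0 : ℝ)..X, Q t * f t) / J| ≤ M := by
    intro f M hf hM
    rw [abs_div, abs_of_pos hJ, div_le_iff₀ hJ]
    exact abs_integral_weight_mul_le hQ hQ0 hf hM X ⟨hX.le, le_rfl⟩
  have hnorm : ∀ (h : BoundedContinuousFunction ℝ ℝ) x, |h x| ≤ ‖h‖ := fun h x =>
    h.norm_coe_le_norm x
  -- Here `A h` is the `Q`-mean of `G h`; subtracting it gives every image `T h` the `Q`-mean `1`.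
  set T : BoundedContinuousFunction ℝ ℝ → BoundedContinuousFunction ℝ ℝ := fun h =>
    BoundedContinuousFunction.ofNormedAddCommGroup (fun x => 1 + G h x - A h)
      ((continuous_const.add (hGc h.continuous (hnorm h))).sub continuous_const)
      (1 + 2 * (B * ‖h‖ + ‖h‖ ^ 2) * √X + 2 * (B * ‖h‖ + ‖h‖ ^ 2) * √X)
      (fun x => by
        have h1 := hGb h.continuous (hnorm h)
        have h2 := havg (hGc h.continuous (hnorm h)) h1
        calc ‖1 + G h x - A h‖ ≤ ‖(1 : ℝ)‖ + ‖G h x‖ + ‖A h‖ :=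
              (norm_sub_le _ _).trans (by gcongr; exact norm_add_le _ _)
          _ ≤ _ := by rw [norm_one]; gcongr; exacts [h1 x, h2]) with hT
  have hTx : ∀ h x, T h x = 1 + G h x - A h := fun h x => rfl
  have hball : ∀ h ∈ Metric.closedBall (1 : BoundedContinuousFunction ℝ ℝ) (1 / 2),
      ∀ x, |h x - 1| ≤ 1 / 2 := fun h hh x => by
    simpa [Real.dist_eq] using (h.dist_coe_le_dist (g := 1) x).trans hh
  have hball2 : ∀ h ∈ Metric.closedBall (1 : BoundedContinuousFunction ℝ ℝ) (1 / 2),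
      ∀ x, |h x| ≤ 3 / 2 := fun h hh x => by
    have := abs_le.1 (hball h hh x)
    rw [abs_le]; constructor <;> linarith
  have hmaps : MapsTo T (Metric.closedBall 1 (1 / 2)) (Metric.closedBall 1 (1 / 2)) := by
    intro h hh
    rw [Metric.mem_closedBall, BoundedContinuousFunction.dist_le (by norm_num)]
    intro x
    have h1 := hGb h.continuous (hball2 h hh)
    have h2 := havg (hGc h.continuous (hball2 h hh)) h1
    have h3 := abs_le.1 (h1 x)
    have h4 := abs_le.1 h2
    rw [hTx, Real.dist_eq]
    simp only [BoundedContinuousFunction.coe_one, Pi.one_apply]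
    rw [abs_le]
    have := Real.sqrt_nonneg X
    -- This needs `(12B + 18)√X ≤ 1`, and the Lipschitz estimate below needs `(8B + 24)√X ≤ 1`;
    -- hence the constant `12B + 24`. Each of `G` and `A` uses half of the allowance `1/2`.
    have h5 : 2 * (B * (3 / 2) + (3 / 2) ^ 2) * √X ≤ 1 / 4 := by nlinarith
    constructor <;> simp only [hA] <;> linarith
  have hlip : ∀ h₁ ∈ Metric.closedBall (1 : BoundedContinuousFunction ℝ ℝ) (1 / 2),
      ∀ h₂ ∈ Metric.closedBall (1 : BoundedContinuousFunction ℝ ℝ) (1 / 2),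
      dist (T h₁) (T h₂) ≤ 1 / 2 * dist h₁ h₂ := by
    intro h₁ hh₁ h₂ hh₂
    rw [BoundedContinuousFunction.dist_le (by positivity)]
    intro x
    have hd : ∀ x, |h₁ x - h₂ x| ≤ dist h₁ h₂ := fun x => by
      simpa [Real.dist_eq] using h₁.dist_coe_le_dist (g := h₂) x
    have c₁ := hGc h₁.continuous (hball2 h₁ hh₁)
    have c₂ := hGc h₂.continuous (hball2 h₂ hh₂)
    have h1 : ∀ x, |G h₁ x - G h₂ x| ≤ 2 * ((B + 2 * (3 / 2)) * dist h₁ h₂) * √X := by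
      intro x
      simp only [hG]
      rw [← intervalIntegral.integral_sub
        (hint h₁.continuous (hball2 h₁ hh₁)).intervalIntegrable
        (hint h₂.continuous (hball2 h₂ hh₂)).intervalIntegrable]
      exact abs_integral_le_of_abs_le_div_sqrt hX.le
        ((hmeas h₁.continuous).sub (hmeas h₂.continuous))
        (abs_integroField_sub_le hQ hQ0 hβB hγB h₁.continuous h₂.continuous
          (hball2 h₁ hh₁) (hball2 h₂ hh₂) hd) x
    have h2 := havg (c₁.sub c₂) h1
    have h3 : A h₁ - A h₂ = (∫ t in (0 : ℝ)..X, Q t * (G h₁ t - G h₂ t)) / J := by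
      rw [integral_weight_mul_sub hQ c₁ c₂, sub_div]
    replace h2 : |A h₁ - A h₂| ≤ _ := h3 ▸ h2
    have h4 := abs_le.1 (h1 x)
    have h5 := abs_le.1 h2
    rw [hTx, hTx, Real.dist_eq, abs_le]
    have h6 : 2 * ((B + 2 * (3 / 2)) * dist h₁ h₂) * √X ≤ 1 / 4 * dist h₁ h₂ := by
      have : 2 * (B + 2 * (3 / 2)) * √X ≤ 1 / 4 := by
        nlinarith [Real.sqrt_nonneg X]
      calc _ = 2 * (B + 2 * (3 / 2)) * √X * dist h₁ h₂ := by ring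
        _ ≤ _ := by gcongr
    constructor <;> linarith
  obtain ⟨h, hhmem, hfix, -⟩ := ContractingWith.exists_fixedPoint' (K := 1 / 2)
    Metric.isClosed_closedBall.isComplete hmaps
    ⟨by rw [← NNReal.coe_lt_coe]; norm_num, LipschitzWith.of_dist_le_mul fun h₁ h₂ => by
      have := hlip h₁ h₁.2 h₂ h₂.2
      norm_num at this ⊢
      exact this⟩
    (Metric.mem_closedBall_self (by norm_num)) (edist_ne_top _ _)
  have hfx : ∀ x, h x = 1 + G h x - A h := fun x => by
    rw [← hTx, hfix.eq]
  have hc := hGc h.continuous (hball2 h hhmem)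
  refine ⟨h, h.continuous, hball h hhmem, ?_, ?_⟩
  · have h1 : ∀ t, Q t * h t = Q t * (G h t - (A h - 1)) := fun t => by rw [hfx]; ring
    simp only [h1]
    rw [integral_weight_mul_sub hQ hc continuous_const, intervalIntegral.integral_mul_const]
    simp only [hA]
    rw [← hJdef]
    field_simp
    ring
  · intro x hx
    have hx' : x ∈ Ioc 0 X := ⟨hx.1, hx.2.le⟩
    have hcF := (continuousOn_integroField hQ hβ hγ h.continuous).mono Ioo_subset_Ioc_self
    have h1 : HasDerivAt (G h) (integroField Q β γ X h x) x :=
      intervalIntegral.integral_hasDerivAt_right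
        (hint h.continuous (hball2 h hhmem)).intervalIntegrable
        (hcF.stronglyMeasurableAtFilter isOpen_Ioo x hx)
        (hcF.continuousAt (isOpen_Ioo.mem_nhds hx))
    have h2 : (h : ℝ → ℝ) = fun x => 1 + G h x - A h := funext hfx
    have h3 : integroField Q β γ X h x
        = β x * (∫ t in (0 : ℝ)..x, Q t * h t) + γ x * h x ^ 2 := by
      simp only [integroField, indicator_of_mem hx']
    rw [← h3]
    have h4 := (h1.const_add 1).sub_const (A h)
    exact h4.congr_of_eventuallyEq (Eventually.of_forall hfx)

end IntegroField

/-! ### Solving the perturbation equation. -/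

theorem mul_sqrt_div_sq {x : ℝ} (hx : 0 < x) : x * √x / x ^ 2 = 1 / √x := by
  have h1 : 0 < √x := Real.sqrt_pos.2 hx
  have h2 : √x * √x = x := Real.mul_self_sqrt hx.le
  rw [div_eq_div_iff (by positivity) h1.ne']
  linear_combination x * h2

/-- Solutions `w`, `v = w'` of `x² w'' = x² q w' + b w + c w'²` with `w 0 = 0` and small
prescribed positive value at `X`. -/
theorem exists_perturbation {q : ℝ → ℝ} {m b c X w₀ : ℝ} (hm : 0 < m) (hc : 0 < c) (hX : 0 < X)
    (hq : ContinuousOn q (Ioc 0 X)) (hlow : ∀ x ∈ Ioc 0 X, m ≤ x * √x * q x)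
    (hup : ∀ x ∈ Ioc 0 X, x * √x * q x ≤ 3 * m)
    (hX1 : 3 / 2 * √X ≤ m) (hX2 : 2 * X + 3 * m * √X ≤ 1)
    (hX3 : (12 * (|b| / m) + 24) * √X ≤ 1) (hw₀ : 0 < w₀) (hcw : c * w₀ ≤ X ^ 3 * √X) :
    ∃ w v : ℝ → ℝ, Continuous w ∧ Continuous v ∧ w 0 = 0 ∧ w X = w₀ ∧
      (∀ x, HasDerivAt w (v x) x) ∧ (∀ x ∈ Ioc 0 X, 0 < v x) ∧
      ∀ x ∈ Ioo 0 X,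
        HasDerivAt v (q x * v x + (b * w x / x ^ 2 + c * v x ^ 2 / x ^ 2)) x ∧
        |b * w x / x ^ 2 + c * v x ^ 2 / x ^ 2| ≤ (3 * |b| / m + 3 / 2) / √x * v x := by
  obtain ⟨Q, hQ, hQz, hpos, hd, hmono⟩ := exists_weight hX hq hlow hX1
  have hJup := mul_integral_weight_le hlow hQ hpos hd
  have hJlow := sq_mul_weight_le_integral hup hX2 hm.le hQ hpos hd X ⟨hX.le, le_rfl⟩
  have hQ0 : ∀ x ∈ Icc 0 X, 0 ≤ Q x := fun x hx => by
    rcases hx.1.eq_or_lt with rfl | h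
    · exact hQz.ge
    · exact (hpos x ⟨h, hx.2⟩).le
  have hQX := hpos X ⟨hX, le_rfl⟩
  have hJ : 0 < ∫ t in (0 : ℝ)..X, Q t := lt_of_lt_of_le (by positivity) hJlow
  set J := ∫ t in (0 : ℝ)..X, Q t with hJdef
  set g := w₀ / J with hg
  have hgpos : 0 < g := div_pos hw₀ hJ
  -- The cubic smallness of `w₀` is used here; monotonicity of `Q / (x√x)` then carries the bound
  -- from `X` to all smaller `s`.
  have hcg : c * g * Q X ≤ X * √X := by
    rw [hg, ← mul_div_assoc, div_mul_eq_mul_div, div_le_iff₀ hJ]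
    calc c * w₀ * Q X ≤ X ^ 3 * √X * Q X := by gcongr
      _ = X * √X * (X ^ 2 * Q X) := by ring
      _ ≤ X * √X * J := by gcongr
  have hγ : ∀ s ∈ Ioc 0 X, c * g * Q s / s ^ 2 ≤ 1 / √s := by
    intro s hs
    have h1 := hmono hs ⟨hX, le_rfl⟩ hs.2
    have hs1 := mul_sqrt_pos hs.1
    have hX1 := mul_sqrt_pos hX
    simp only at h1
    rw [div_le_div_iff₀ hs1 hX1] at h1
    rw [← mul_sqrt_div_sq hs.1]
    refine div_le_div_of_nonneg_right (le_of_mul_le_mul_right ?_ hX1) (sq_nonneg s)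
    calc c * g * Q s * (X * √X) = c * g * (Q s * (X * √X)) := by ring
      _ ≤ c * g * (Q X * (s * √s)) := by gcongr
      _ = c * g * Q X * (s * √s) := by ring
      _ ≤ X * √X * (s * √s) := by gcongr
      _ = s * √s * (X * √X) := by ring
  obtain ⟨h, hhc, hh1, hhavg, hhd⟩ := exists_integroField_solution (Q := Q)
    (β := fun s => b / (s ^ 2 * Q s)) (γ := fun s => c * g * Q s / s ^ 2) (X := X)
    (B := |b| / m) hX hQ hQ0 hJ
    (by
      apply continuousOn_const.div (by fun_prop)
      exact fun s hs => (mul_pos (pow_pos hs.1 2) (hpos s hs)).ne')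
    (by
      apply ContinuousOn.div (by fun_prop) (by fun_prop)
      exact fun s hs => (pow_pos hs.1 2).ne')
    (by positivity)
    (fun s hs => by
      have h1 := hpos s hs
      have h2 := hJup s ⟨hs.1.le, hs.2⟩
      have h3 := hs.1
      rw [abs_div, abs_of_pos (mul_pos (pow_pos hs.1 2) (hpos s hs)), div_div,
        div_mul_eq_mul_div, div_le_div_iff₀ (by positivity)
        (mul_pos hm (Real.sqrt_pos.2 hs.1))]
      calc |b| * (∫ t in (0 : ℝ)..s, Q t) * (m * √s)
          = |b| * √s * (m * ∫ t in (0 : ℝ)..s, Q t) := by ring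
        _ ≤ |b| * √s * (s * √s * Q s) := by gcongr
        _ = |b| * s * (√s * √s) * Q s := by ring
        _ = _ := by rw [Real.mul_self_sqrt hs.1.le]; ring)
    (fun s hs => by
      have h1 := hpos s hs
      rw [abs_of_nonneg (by positivity)]
      exact hγ s hs) hX3
  have hhb : ∀ x, 1 / 2 ≤ h x ∧ h x ≤ 3 / 2 := fun x => by
    have := abs_le.1 (hh1 x)
    constructor <;> linarith
  have hQh : Continuous fun t => Q t * h t := hQ.mul hhc
  have hw' : ∀ x, HasDerivAt (fun x => g * ∫ t in (0 : ℝ)..x, Q t * h t) (g * (Q x * h x)) x :=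
    fun x => (hasDerivAt_primitive hQh x).const_mul g
  refine ⟨fun x => g * ∫ t in (0 : ℝ)..x, Q t * h t, fun x => g * (Q x * h x),
    continuous_const.mul (continuous_primitive_zero hQh), continuous_const.mul hQh, by simp,
    ?_, hw', ?_, ?_⟩
  · simp only [hhavg, ← hJdef, hg]
    field_simp
  · intro x hx
    have := hpos x hx
    have := (hhb x).1
    positivity
  · intro x hx
    have hx0 := hx.1
    have hx' : x ∈ Ioc 0 X := ⟨hx.1, hx.2.le⟩
    have hQx := hpos x hx'
    set I := ∫ t in (0 : ℝ)..x, Q t * h t with hI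
    obtain ⟨hx1, hx2⟩ := hhb x
    constructor
    · have h1 := ((hd x hx).mul (hhd x hx)).const_mul g
      convert! h1 using 1
      rw [← hI]
      field_simp
      ring
    · have hIb : m * |I| ≤ 3 / 2 * (x * √x * Q x) := by
        have h1 := abs_integral_weight_mul_le hQ hQ0 hhc
          (M := 3 / 2) (fun x => by
            rw [abs_le]; constructor <;> linarith [(hhb x).1, (hhb x).2]) x ⟨hx0.le, hx.2.le⟩
        have h2 := hJup x ⟨hx0.le, hx.2.le⟩
        rw [← hI] at h1
        nlinarith
      have hsx := Real.sqrt_pos.2 hx0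
      -- The factor `3` is the ratio of the bounds `3/2` and `1/2` for `h`: the integral is bounded
      -- with the upper one and compared with `v` through the lower one.
      have hA : |b * (g * I) / x ^ 2| ≤ 3 * |b| / m / √x * (g * (Q x * h x)) := by
        rw [abs_div, abs_mul, abs_mul, abs_of_pos hgpos, abs_of_pos (pow_pos hx0 2)]
        have h3 : |I| ≤ 3 / 2 * (x * √x * Q x) / m := by
          rw [le_div_iff₀ hm]; linarith
        calc |b| * (g * |I|) / x ^ 2
            ≤ |b| * (g * (3 / 2 * (x * √x * Q x) / m)) / x ^ 2 := by gcongr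
          _ = |b| * g * (3 / 2) * Q x / m * (x * √x / x ^ 2) := by ring
          _ = 3 * |b| / m / √x * (g * (Q x * (1 / 2))) := by
            rw [mul_sqrt_div_sq hx0]; ring
          _ ≤ _ := by gcongr
      have hC : |c * (g * (Q x * h x)) ^ 2 / x ^ 2| ≤ 3 / 2 / √x * (g * (Q x * h x)) := by
        have hh0 : 0 < h x := by linarith
        rw [abs_of_nonneg (by positivity)]
        calc c * (g * (Q x * h x)) ^ 2 / x ^ 2
            = (c * g * Q x / x ^ 2) * h x * (g * (Q x * h x)) := by ring
          _ ≤ 1 / √x * (3 / 2) * (g * (Q x * h x)) := by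
            exact mul_le_mul_of_nonneg_right (mul_le_mul (hγ x hx') hx2 hh0.le (by positivity))
              (by positivity)
          _ = _ := by ring
      calc _ ≤ |b * (g * I) / x ^ 2| + |c * (g * (Q x * h x)) ^ 2 / x ^ 2| := abs_add_le _ _
        _ ≤ _ := by
          refine (add_le_add hA hC).trans_eq ?_
          ring

/-! ### Comparison with the barriers `x ^ α exp (-4m / √x)`. -/

theorem hasDerivAt_rpow_mul_exp_div_sqrt (α m : ℝ) {x : ℝ} (hx : 0 < x) :
    HasDerivAt (fun x : ℝ => x ^ (-α) * Real.exp (4 * m / √x))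
      (-(α / x + 2 * m / (x * √x)) * (x ^ (-α) * Real.exp (4 * m / √x))) x := by
  have hs := Real.sqrt_pos.2 hx
  have h2 : √x * √x = x := Real.mul_self_sqrt hx.le
  have h1 : HasDerivAt (fun x : ℝ => x ^ (-α)) (-α * x ^ (-α - 1)) x :=
    Real.hasDerivAt_rpow_const (Or.inl hx.ne')
  have h3 : HasDerivAt (fun x : ℝ => 4 * m / √x) (-(2 * m / (x * √x))) x := by
    have := (hasDerivAt_const x (4 * m)).div (Real.hasDerivAt_sqrt hx.ne') hs.ne'
    refine this.congr_deriv ?_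
    rw [← h2, Real.sqrt_mul_self hs.le]
    field_simp
    ring
  refine (h1.mul h3.exp).congr_deriv ?_
  rw [Real.rpow_sub_one hx.ne']
  ring

/-- Comparison of a positive increasing function with `x ^ α exp (-4 m / √x)`: the quotient is
monotone if the logarithmic derivative `ρ` of `v = w'` lies on one side of that of the barrier.
The factor `σ` selects the side. -/
theorem mul_rpow_mul_exp_le {w v ρ : ℝ → ℝ} {m α σ X : ℝ} (hm : 0 < m)
    (hα : |α| * √X ≤ m) (hw : Continuous w) (hv : Continuous v) (hw0 : w 0 = 0)
    (hwd : ∀ x, HasDerivAt w (v x) x) (hvpos : ∀ x ∈ Ioc 0 X, 0 < v x)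
    (hvd : ∀ x ∈ Ioo 0 X, HasDerivAt v (ρ x * v x) x)
    (hρ : ∀ x ∈ Ioo 0 X, 0 ≤ σ * (3 / 2 * √x - α * x / (2 * (2 * m + α * √x))
      + x * √x * ρ x - (2 * m + α * √x))) :
    ∀ x ∈ Ioc 0 X, σ * (w x * (x ^ (-α) * Real.exp (4 * m / √x))) ≤
      σ * (w X * (X ^ (-α) * Real.exp (4 * m / √X))) := by
  have hD : ∀ x ∈ Icc 0 X, 0 < 2 * m + α * √x := by
    intro x hx
    have h1 : √x ≤ √X := Real.sqrt_le_sqrt hx.2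
    have h2 : |α * √x| ≤ m := by
      rw [abs_mul, abs_of_nonneg (Real.sqrt_nonneg x)]
      exact (mul_le_mul_of_nonneg_left h1 (abs_nonneg α)).trans hα
    linarith [(abs_le.1 h2).1]
  -- With `D = 2m + α√x`, the barrier has logarithmic derivative `D / (x√x)`, so the quotient is
  -- monotone exactly according to the sign of `x√x v / D - w`. This vanishes at `0`, and its
  -- derivative is `v / D` times the expression in `hρ`.
  have hy := nonneg_of_hasDerivAt_nonneg (X := X)
    (f := fun x => σ * (x * √x / (2 * m + α * √x) * v x - w x))
    (f' := fun x => σ * (((3 / 2 * √x * (2 * m + α * √x) - x * √x * (α * (1 / (2 * √x))))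
      / (2 * m + α * √x) ^ 2 * v x + x * √x / (2 * m + α * √x) * (ρ x * v x)) - v x))
    (by
      refine continuousOn_const.mul (((ContinuousOn.div (by fun_prop) (by fun_prop)
        fun x hx => (hD x hx).ne').mul hv.continuousOn).sub hw.continuousOn))
    (by simp [hw0])
    (fun x hx => by
      have h1 := ((Real.hasDerivAt_sqrt hx.1.ne').const_mul α).const_add (2 * m)
      exact ((((hasDerivAt_mul_sqrt hx.1).div h1 (hD x ⟨hx.1.le, hx.2.le⟩).ne').mul
        (hvd x hx)).sub (hwd x)).const_mul σ)
    (fun x hx => by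
      have h1 := hD x ⟨hx.1.le, hx.2.le⟩
      have h2 := hvpos x ⟨hx.1, hx.2.le⟩
      have h3 := Real.sqrt_pos.2 hx.1
      have h4 := hρ x hx
      set D := 2 * m + α * √x with hDdef
      have : σ * (((3 / 2 * √x * D - x * √x * (α * (1 / (2 * √x)))) / D ^ 2 * v x
          + x * √x / D * (ρ x * v x)) - v x)
          = v x / D * (σ * (3 / 2 * √x - α * x / (2 * D) + x * √x * ρ x - D)) := by
        field_simp
      rw [this]
      positivity)
  have hmono : MonotoneOn (fun x => σ * (w x * (x ^ (-α) * Real.exp (4 * m / √x))))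
      (Ioc 0 X) := by
    have hd : ∀ x, 0 < x → HasDerivAt
        (fun x => σ * (w x * (x ^ (-α) * Real.exp (4 * m / √x))))
        (σ * (v x * (x ^ (-α) * Real.exp (4 * m / √x))
          + w x * (-(α / x + 2 * m / (x * √x)) * (x ^ (-α) * Real.exp (4 * m / √x))))) x :=
      fun x hx => ((hwd x).mul (hasDerivAt_rpow_mul_exp_div_sqrt α m hx)).const_mul σ
    apply monotoneOn_of_deriv_nonneg (convex_Ioc 0 X)
    · exact fun x hx => (hd x hx.1).continuousAt.continuousWithinAt
    · rw [interior_Ioc]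
      exact fun x hx => (hd x hx.1).differentiableAt.differentiableWithinAt
    · rw [interior_Ioc]
      intro x hx
      rw [(hd x hx.1).deriv]
      have h1 := hD x ⟨hx.1.le, hx.2.le⟩
      have h3 := Real.sqrt_pos.2 hx.1
      have h4 := hy x ⟨hx.1.le, hx.2.le⟩
      have h5 := hx.1
      set D := 2 * m + α * √x with hDdef
      have : σ * (v x * (x ^ (-α) * Real.exp (4 * m / √x))
          + w x * (-(α / x + 2 * m / (x * √x)) * (x ^ (-α) * Real.exp (4 * m / √x))))
          = D / (x * √x) * (x ^ (-α) * Real.exp (4 * m / √x))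
            * (σ * (x * √x / D * v x - w x)) := by
        have h6 : α / x + 2 * m / (x * √x) = D / (x * √x) := by
          rw [hDdef]; field_simp; ring
        rw [h6]
        field_simp
        ring
      rw [this]
      positivity
  exact fun x hx => hmono hx ⟨hx.1.trans_le hx.2, le_rfl⟩ hx.2

/-- Two-sided control of the deviation of the logarithmic derivative from that of the barrier. -/
theorem abs_logDeriv_gap_le {ρ m a l K α x X : ℝ} (hm : 0 < m) (hK : 0 ≤ K) (hx : x ∈ Ioo 0 X)
    (hα : |α| * √X ≤ m) (hρ : |x * √x * ρ - (2 * m + a * √x)| ≤ l * √x + K * x) :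
    |3 / 2 * √x - α * x / (2 * (2 * m + α * √x)) + x * √x * ρ - (2 * m + α * √x)
      - (3 / 2 + a - α) * √x| ≤ l * √x + (K + |α| / (2 * m)) * √X * √x := by
  have hx0 := hx.1
  have hs := Real.sqrt_pos.2 hx0
  have h1 : √x ≤ √X := Real.sqrt_le_sqrt hx.2.le
  have h2 : |α * √x| ≤ m := by
    rw [abs_mul, abs_of_pos hs]
    exact (mul_le_mul_of_nonneg_left h1 (abs_nonneg α)).trans hα
  have hD : m ≤ 2 * m + α * √x := by linarith [(abs_le.1 h2).1]
  have hsq : √x * √x = x := Real.mul_self_sqrt hx0.le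
  have h3 : |α * x / (2 * (2 * m + α * √x))| ≤ |α| / (2 * m) * x := by
    rw [abs_div, abs_mul, abs_of_pos hx0, abs_of_pos (by linarith : 0 < 2 * (2 * m + α * √x)),
      div_mul_eq_mul_div]
    gcongr
  have h4 : x ≤ √X * √x := by
    calc x = √x * √x := hsq.symm
      _ ≤ √X * √x := by gcongr
  calc _ = |(x * √x * ρ - (2 * m + a * √x)) - α * x / (2 * (2 * m + α * √x))| := by
        congr 1; ring
    _ ≤ _ := abs_sub _ _
    _ ≤ l * √x + K * x + |α| / (2 * m) * x := add_le_add hρ h3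
    _ = l * √x + (K + |α| / (2 * m)) * x := by ring
    _ ≤ l * √x + (K + |α| / (2 * m)) * (√X * √x) := by gcongr
    _ = _ := by ring

/-! ### Smallness conditions near the origin. -/

theorem eventually_mul_sqrt_le (C : ℝ) {d : ℝ} (hd : 0 < d) :
    ∀ᶠ x : ℝ in 𝓝[>] 0, C * √x ≤ d := by
  have h : Continuous fun x : ℝ => C * √x := by fun_prop
  have h1 : Tendsto (fun x : ℝ => C * √x) (𝓝[>] 0) (𝓝 (C * √0)) :=
    (h.tendsto 0).mono_left nhdsWithin_le_nhds
  exact h1.eventually_le_const (by simpa using hd)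

/-- The factor `exp (-d / √x)` is smaller near `0` than every power of `x`. -/
theorem eventually_mul_rpow_mul_exp_le (c α : ℝ) {d : ℝ} (hd : 0 < d) :
    ∀ᶠ x : ℝ in 𝓝[>] 0, c * (x ^ α * Real.exp (-d / √x)) ≤ x ^ 3 * √x := by
  have h1 : Tendsto (fun x : ℝ => (√x)⁻¹) (𝓝[>] 0) atTop := by
    apply tendsto_inv_nhdsGT_zero.comp
    apply tendsto_nhdsWithin_of_tendsto_nhds_of_eventually_within
    · have := (Real.continuous_sqrt.tendsto 0).mono_left (nhdsWithin_le_nhds (s := Ioi 0))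
      simpa using this
    · filter_upwards [self_mem_nhdsWithin] with x hx
      exact Real.sqrt_pos.2 hx
  -- With `t = 1/√x`, the ratio `x^α / x^{7/2}` is `t^{7 - 2α}`.
  have h2 := ((tendsto_rpow_mul_exp_neg_mul_atTop_nhds_zero (7 - 2 * α) d hd).const_mul c).comp h1
  rw [mul_zero] at h2
  filter_upwards [h2.eventually_le_const zero_lt_one, self_mem_nhdsWithin] with x hx hx0
  have hx0 : 0 < x := hx0
  simp only [Function.comp] at hx
  have h3 : (√x)⁻¹ ^ (7 - 2 * α) = x ^ α / (x ^ 3 * √x) := by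
    rw [Real.sqrt_eq_rpow, ← Real.rpow_neg hx0.le, ← Real.rpow_mul hx0.le, ← Real.rpow_natCast,
      ← Real.rpow_add hx0, ← Real.rpow_sub hx0]
    congr 1
    push_cast
    ring
  have h4 := mul_sqrt_pos hx0
  have h5 : 0 < x ^ 3 * √x := by
    have := Real.sqrt_pos.2 hx0
    positivity
  rw [h3, ← div_eq_mul_inv (-d) (√x)] at hx
  have h6 : c * (x ^ α / (x ^ 3 * √x) * Real.exp (-d / √x))
      = c * (x ^ α * Real.exp (-d / √x)) / (x ^ 3 * √x) := by ring
  rwa [h6, div_le_one h5] at hx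

theorem rpow_mul_exp_eq_inv (α d : ℝ) {x : ℝ} (hx : 0 < x) :
    x ^ α * Real.exp (-d / √x) = (x ^ (-α) * Real.exp (d / √x))⁻¹ := by
  rw [mul_inv, Real.rpow_neg hx.le, inv_inv, ← Real.exp_neg, neg_div]

/-! ### Return to the original equation. -/

theorem contDiffOn_two_of_hasDerivAt {f f' f'' : ℝ → ℝ} {s : Set ℝ} (hs : IsOpen s)
    (hf : ∀ x ∈ s, HasDerivAt f (f' x) x) (hf' : ∀ x ∈ s, HasDerivAt f' (f'' x) x)
    (hf'' : ContinuousOn f'' s) : ContDiffOn ℝ 2 f s := by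
  have h1 : ContDiffOn ℝ 1 f' s := by
    rw [show (1 : WithTop ℕ∞) = 0 + 1 from rfl, contDiffOn_succ_iff_deriv_of_isOpen hs]
    refine ⟨fun x hx => (hf' x hx).differentiableAt.differentiableWithinAt, by simp, ?_⟩
    rw [contDiffOn_zero]
    exact hf''.congr fun x hx => (hf' x hx).deriv
  rw [show (2 : WithTop ℕ∞) = 1 + 1 from by norm_num, contDiffOn_succ_iff_deriv_of_isOpen hs]
  exact ⟨fun x hx => (hf x hx).differentiableAt.differentiableWithinAt, by simp,
    h1.congr fun x hx => (hf x hx).deriv⟩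

/-- Subtracting a solution of the perturbation equation from a solution. -/
theorem IsSolution.sub {a b c x₀ X : ℝ} {u w v : ℝ → ℝ} (hu : IsSolution a b c x₀ u)
    (hX : X < x₀) (hw : Continuous w) (hv : Continuous v) (hw0 : w 0 = 0)
    (hwd : ∀ x, HasDerivAt w (v x) x)
    (hvd : ∀ x ∈ Ioo 0 X, HasDerivAt v ((a * x - 2 * c * (deriv u x - 1)) / x ^ 2 * v x
      + (b * w x / x ^ 2 + c * v x ^ 2 / x ^ 2)) x) :
    IsSolution a b c X (fun x => u x - w x) := by
  have hsub : Ioo 0 X ⊆ Ioo 0 x₀ := Ioo_subset_Ioo_right hX.le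
  have hu' : ContDiffOn ℝ 1 (deriv u) (Ioo 0 x₀) :=
    hu.contDiffOn.deriv_of_isOpen isOpen_Ioo (by norm_num)
  have hud : ∀ x ∈ Ioo 0 x₀, DifferentiableAt ℝ u x := fun x hx =>
    (hu.contDiffOn.differentiableOn (by norm_num)).differentiableAt (isOpen_Ioo.mem_nhds hx)
  have hud' : ∀ x ∈ Ioo 0 x₀, DifferentiableAt ℝ (deriv u) x := fun x hx =>
    (hu'.differentiableOn (by norm_num)).differentiableAt (isOpen_Ioo.mem_nhds hx)
  have hd : ∀ x ∈ Ioo 0 X, deriv (fun x => u x - w x) x = deriv u x - v x := fun x hx =>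
    ((hud x (hsub hx)).hasDerivAt.sub (hwd x)).deriv
  refine ⟨(hu.continuousOn.mono (Icc_subset_Icc_right hX.le)).sub hw.continuousOn, ?_, ?_, ?_⟩
  · refine (hu.contDiffOn.mono hsub).sub
      (contDiffOn_two_of_hasDerivAt isOpen_Ioo (fun x _ => hwd x) hvd ?_)
    have h1 : ContinuousOn (deriv u) (Ioo 0 X) := hu'.continuousOn.mono hsub
    have h0 : ∀ x ∈ Ioo 0 X, x ^ 2 ≠ 0 := fun x hx => (pow_pos hx.1 2).ne'
    fun_prop (disch := assumption)
  · intro x hx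
    have h1 : deriv (deriv fun x => u x - w x) x = deriv (deriv u) x -
        ((a * x - 2 * c * (deriv u x - 1)) / x ^ 2 * v x
          + (b * w x / x ^ 2 + c * v x ^ 2 / x ^ 2)) := by
      have h2 : deriv (fun x => u x - w x) =ᶠ[𝓝 x] fun x => deriv u x - v x := by
        filter_upwards [isOpen_Ioo.mem_nhds hx] with y hy using hd y hy
      rw [h2.deriv_eq]
      exact ((hud' x (hsub hx)).hasDerivAt.sub (hvd x hx)).deriv
    have h3 := hu.equation x (hsub hx)
    have hx0 : x ≠ 0 := hx.1.ne'
    have h4 : x ^ 2 * ((a * x - 2 * c * (deriv u x - 1)) / x ^ 2 * v x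
          + (b * w x / x ^ 2 + c * v x ^ 2 / x ^ 2))
        = (a * x - 2 * c * (deriv u x - 1)) * v x + b * w x + c * v x ^ 2 := by
      field_simp
      ring
    rw [h1, hd x hx]
    linear_combination h3 - h4
  · simp [hu.initial, hw0]

/-! ### Choice of the interval and conclusion. -/

theorem proposition5p5 (a b c : ℝ) (hc : 0 < c) (hab : 0 < a + b)
    (x₀ : ℝ) (hx₀ : 0 < x₀) (u : ℝ → ℝ) (hu : IsSolution a b c x₀ u)
    (l : ℝ) (hl : 0 < l)
    (hkl : ∀ x ∈ Set.Ioo 0 x₀,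
      |(deriv u x - 1) / Real.sqrt x + kCoeff a b c| ≤ l * Real.sqrt x)
    (αlow αup : ℝ) (hlow : αlow < 3 / 2 + a - 2 * c * l) (hup : 3 / 2 + a + 2 * c * l < αup) :
    ∃ xhat : ℝ, 0 < xhat ∧ xhat < x₀ ∧ xhat < 1 ∧
      ∀ ε ∈ Set.Ioo (0 : ℝ) 1,
        ∀ uhat₀ ∈ Set.Ioo (expPerturbation a b c u ε αlow xhat)
            (expPerturbation a b c u ε αup xhat),
          ∃ uhat : ℝ → ℝ, IsSolution a b c xhat uhat ∧
            (∀ x ∈ Set.Ioo 0 xhat,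
              expPerturbation a b c u ε αlow x ≤ uhat x ∧
                uhat x ≤ expPerturbation a b c u ε αup x) ∧
            uhat xhat = uhat₀ := by
  have hk : 0 < kCoeff a b c := Real.sqrt_pos.2 (div_pos hab hc)
  set k := kCoeff a b c with hkdef
  set m := c * k with hmdef
  have hm : 0 < m := mul_pos hc hk
  set K := 3 * |b| / m + 3 / 2 with hKdef
  have hK : 0 ≤ K := by positivity
  -- In order: `x√x q` lies in `[m, 3m]`; existence of the perturbation; positivity of `2m + α√x`;
  -- error terms absorbed in the strict gaps of the two exponents; and smallness of the value at
  -- `X`. None involves `ε`.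
  obtain ⟨X, hX, hXx₀, hX1, ham, hXm, hX2, hX3, hαl, hαu, hgl, hgu, hexp⟩ : ∃ X : ℝ, 0 < X ∧
      X < x₀ ∧ X < 1 ∧ (|a| + 2 * c * l) * √X ≤ m ∧ 3 / 2 * √X ≤ m ∧
      (2 + 3 * m) * √X ≤ 1 ∧ (12 * (|b| / m) + 24) * √X ≤ 1 ∧
      |αlow| * √X ≤ m ∧ |αup| * √X ≤ m ∧
      (K + |αlow| / (2 * m)) * √X ≤ 3 / 2 + a - 2 * c * l - αlow ∧
      (K + |αup| / (2 * m)) * √X ≤ αup - (3 / 2 + a + 2 * c * l) ∧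
      c * (X ^ αlow * Real.exp (-(4 * c * k) / √X)) ≤ X ^ 3 * √X := by
    have h1 : ∀ d : ℝ, 0 < d → ∀ᶠ x : ℝ in 𝓝[>] 0, x < d := fun d hd =>
      (eventually_lt_nhds hd).filter_mono nhdsWithin_le_nhds
    have h2 := eventually_mul_rpow_mul_exp_le c αlow (d := 4 * c * k) (by positivity)
    refine Eventually.exists (f := 𝓝[>] (0 : ℝ)) ?_
    filter_upwards [self_mem_nhdsWithin, h1 x₀ hx₀, h1 1 one_pos,
      eventually_mul_sqrt_le (|a| + 2 * c * l) hm, eventually_mul_sqrt_le (3 / 2) hm,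
      eventually_mul_sqrt_le (2 + 3 * m) one_pos,
      eventually_mul_sqrt_le (12 * (|b| / m) + 24) one_pos,
      eventually_mul_sqrt_le |αlow| hm, eventually_mul_sqrt_le |αup| hm,
      eventually_mul_sqrt_le (K + |αlow| / (2 * m)) (sub_pos.2 hlow),
      eventually_mul_sqrt_le (K + |αup| / (2 * m)) (sub_pos.2 hup), h2]
      with x e1 e2 e3 e4 e5 e6 e7 e8 e9 e10 e11 e12
    exact ⟨e1, e2, e3, e4, e5, e6, e7, e8, e9, e10, e11, e12⟩
  refine ⟨X, hX, hXx₀, hX1, ?_⟩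
  rintro ε ⟨hε0, hε1⟩ uhat₀ ⟨hlo, hhi⟩
  have hsX := Real.sqrt_pos.2 hX
  have hsX1 : √X ≤ 1 := Real.sqrt_le_one.2 hX1.le
  have hXsqrt : X ≤ √X := by
    nlinarith [Real.mul_self_sqrt hX.le]
  unfold expPerturbation at hlo hhi
  rw [← hkdef] at hlo hhi
  set q : ℝ → ℝ := fun x => (a * x - 2 * c * (deriv u x - 1)) / x ^ 2 with hqdef
  have hqc : ContinuousOn q (Ioc 0 X) := by
    have h1 : ContinuousOn (deriv u) (Ioc 0 X) :=
      (hu.contDiffOn.continuousOn_deriv_of_isOpen isOpen_Ioo (by norm_num)).mono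
        fun x hx => ⟨hx.1, hx.2.trans_lt hXx₀⟩
    have h0 : ∀ x ∈ Ioc 0 X, x ^ 2 ≠ 0 := fun x hx => (pow_pos hx.1 2).ne'
    fun_prop (disch := assumption)
  have hqb : ∀ x ∈ Ioc 0 X, |x * √x * q x - (2 * m + a * √x)| ≤ 2 * c * l * √x := by
    intro x hx
    have hs := Real.sqrt_pos.2 hx.1
    have h1 := hkl x ⟨hx.1, hx.2.trans_lt hXx₀⟩
    have h2 : x * √x * q x - (2 * m + a * √x) = -(2 * c) * ((deriv u x - 1) / √x + k) := by
      have h3 : x * √x * q x = (x * √x / x ^ 2) * (a * x - 2 * c * (deriv u x - 1)) := by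
        simp only [hqdef]; ring
      have h4 : 1 / √x * (a * x) = a * √x := by
        rw [one_div, inv_mul_eq_div, div_eq_iff hs.ne', mul_assoc, Real.mul_self_sqrt hx.1.le]
      rw [h3, mul_sqrt_div_sq hx.1, mul_sub, h4, hmdef]
      ring
    rw [h2, abs_mul, abs_neg, abs_of_pos (by positivity : 0 < 2 * c), mul_assoc (2 * c)]
    gcongr
  have hqr : ∀ x ∈ Ioc 0 X, m ≤ x * √x * q x ∧ x * √x * q x ≤ 3 * m := by
    intro x hx
    have h1 : √x ≤ √X := Real.sqrt_le_sqrt hx.2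
    have h2 := abs_le.1 (hqb x hx)
    have h3 : |a * √x| + 2 * c * l * √x ≤ m := by
      rw [abs_mul, abs_of_nonneg (Real.sqrt_nonneg x), ← add_mul]
      refine le_trans ?_ ham
      gcongr
    have h4 := abs_le.1 (le_refl |a * √x|)
    constructor <;> linarith
  have hw₀l : u X - uhat₀ ≤ ε * (X ^ αlow * Real.exp (-(4 * c * k) / √X)) := by linarith
  have hw₀u : ε * (X ^ αup * Real.exp (-(4 * c * k) / √X)) ≤ u X - uhat₀ := by linarith
  have hw₀ : 0 < u X - uhat₀ := lt_of_lt_of_le (by positivity) hw₀u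
  obtain ⟨w, v, hw, hv, hw0, hwX, hwd, hvpos, hvd⟩ := exists_perturbation (b := b)
    (w₀ := u X - uhat₀) hm hc hX hqc (fun x hx => (hqr x hx).1) (fun x hx => (hqr x hx).2) hXm
    -- Since `ε < 1`, the condition `c w₀ ≤ X³√X` follows from the bound fixed for `ε = 1`.
    (by linarith) hX3 hw₀ (by
      refine le_trans ?_ hexp
      gcongr
      refine hw₀l.trans (mul_le_of_le_one_left (by positivity) hε1.le))
  set e : ℝ → ℝ := fun x => b * w x / x ^ 2 + c * v x ^ 2 / x ^ 2 with hedef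
  set ρ : ℝ → ℝ := fun x => q x + e x / v x with hρdef
  have hρd : ∀ x ∈ Ioo 0 X, HasDerivAt v (ρ x * v x) x := fun x hx => by
    have h1 := hvpos x ⟨hx.1, hx.2.le⟩
    convert! (hvd x hx).1 using 1
    simp only [hρdef, hedef]
    field_simp
  have hρb : ∀ x ∈ Ioo 0 X, |x * √x * ρ x - (2 * m + a * √x)| ≤ 2 * c * l * √x + K * x := by
    intro x hx
    have h1 := hvpos x ⟨hx.1, hx.2.le⟩
    have hs := Real.sqrt_pos.2 hx.1
    have hx0 := hx.1
    have h2 : |x * √x * (e x / v x)| ≤ K * x := by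
      rw [abs_mul, abs_div, abs_of_pos h1, abs_of_pos (mul_sqrt_pos hx.1)]
      have h3 : |e x| / v x ≤ K / √x := by
        rw [div_le_iff₀ h1]
        exact (hvd x hx).2
      calc _ ≤ x * √x * (K / √x) := by gcongr
        _ = K * x := by field_simp
    have h4 : x * √x * ρ x - (2 * m + a * √x)
        = (x * √x * q x - (2 * m + a * √x)) + x * √x * (e x / v x) := by
      simp only [hρdef]; ring
    rw [h4]
    exact (abs_add_le _ _).trans (add_le_add (hqb x ⟨hx.1, hx.2.le⟩) h2)
  -- For the lower exponent the quotient increases, so its value at `X`, at most `ε`, bounds it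
  -- above; for the upper exponent it decreases, so its value at `X`, at least `ε`, bounds it below.
  have hbl := mul_rpow_mul_exp_le (σ := 1) hm hαl hw hv hw0 hwd hvpos hρd (fun x hx => by
    have h1 := abs_le.1 (abs_logDeriv_gap_le hm hK hx hαl (hρb x hx))
    have h2 := mul_le_mul_of_nonneg_right hgl (Real.sqrt_nonneg x)
    linarith)
  have hbu := mul_rpow_mul_exp_le (σ := -1) hm hαu hw hv hw0 hwd hvpos hρd (fun x hx => by
    have h1 := abs_le.1 (abs_logDeriv_gap_le hm hK hx hαu (hρb x hx))
    have h2 := mul_le_mul_of_nonneg_right hgu (Real.sqrt_nonneg x)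
    linarith)
  refine ⟨fun x => u x - w x, hu.sub hXx₀ hw hv hw0 hwd fun x hx => (hvd x hx).1, ?_, ?_⟩
  · intro x hx
    unfold expPerturbation
    rw [← hkdef]
    have hx' : x ∈ Ioc 0 X := ⟨hx.1, hx.2.le⟩
    have hx0 := hx.1
    have h4 : 4 * c * k = 4 * m := by rw [hmdef]; ring
    rw [h4, rpow_mul_exp_eq_inv _ _ hX, ← div_eq_mul_inv] at hw₀l hw₀u
    rw [h4, mul_assoc ε, mul_assoc ε, rpow_mul_exp_eq_inv _ _ hx.1, rpow_mul_exp_eq_inv _ _ hx.1,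
      ← div_eq_mul_inv, ← div_eq_mul_inv]
    rw [le_div_iff₀ (by positivity)] at hw₀l
    rw [div_le_iff₀ (by positivity)] at hw₀u
    have h5 := hbl x hx'
    have h6 := hbu x hx'
    rw [hwX] at h5 h6
    constructor
    · apply sub_le_sub_left
      rw [le_div_iff₀ (by positivity)]
      linarith
    · apply sub_le_sub_left
      rw [div_le_iff₀ (by positivity)]
      linarith
  · simp [hwX]
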